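/- Let $I=[-1,1]$, and let $I^\infty$ be the set of real sequences $a=(a_k)_{k\ge 0}$ with $a_k\in I$, equipped with the product probability measure $\mu$ of the normalized Lebesgue measures on the factors (so the $a_k$ are independent and uniformly distributed in $[-1,1]$). Identify $a\in I^\infty$ with the analytic function $f(z)=\sum_{k\ge 0}a_kz^k$ on the open unit disc. Let $D_{1/4}=\{z\in\mathbb C:|z|\le 1/4\}$ and, for $d\ge 1$, let $$\mathcal Z_d(f)=\sup\ \#\Big\{z\in D_{1/4}:\ \sum_{j=0}^d p_j(z)f(z)^j=0\Big\}\in\mathbb N\cup\{\infty\},$$ where zeros are counted with multiplicity and the supremum is over all $p_0,\dots,p_d\in\mathbb C[z]$ of degree at most $d$, not all zero. Then there are constants $C_p$, $p\in(0,1)$, with $C_p\to+\infty$ as $p\to 1$, such that for every $p\in(0,1)$ there is a measurable set $E_p\subset I^\infty$ with $\mu(E_p)=p$ and $$\mathcal Z_d(f)\le C_p\,d^8\qquad\text{for all } f\in E_p \text{ and all } d\ge 1.$$ Moreover, with probability one, random power series satisfy polynomial Bézout bounds of degree at most $8$: for $\mu$-almost every $f\in I^\infty$ there is a constant $C$ such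 that $\mathcal Z_d(f)\le C\,d^8$ for all $d\ge 1$. -/

import Mathlib

open MeasureTheory Filter Topology
open scoped ENNReal Polynomial

namespace RandomBezout

/-- The interval `I = [-1, 1]`. -/
abbrev I : Set ℝ := Set.Icc (-1) 1

/-- The infinite dimensional cube `I^∞` of real sequences `(a_k)_{k ≥ 0}` with `a_k ∈ [-1, 1]`. -/
abbrev Cube : Type := ℕ → I

/-- The normalized Lebesgue measure on `[-1, 1]`. -/
noncomputable def uniformI : Measure I := (2 : ℝ≥0∞)⁻¹ • Measure.comap Subtype.val volume

instance : IsProbabilityMeasure uniformI where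
  measure_univ := by
    have h : Measure.comap (Subtype.val : I → ℝ) volume Set.univ = 2 := by
      rw [Measure.comap_apply _ Subtype.val_injective
        (fun s hs => measurableSet_Icc.subtype_image hs) _ MeasurableSet.univ]
      rw [Set.image_univ, Subtype.range_coe, Real.volume_Icc]
      norm_num
    rw [uniformI, Measure.smul_apply, h, smul_eq_mul]
    exact ENNReal.inv_mul_cancel (by norm_num) (by norm_num)

/-- The product probability measure on `I^∞`: the coordinates are independent and uniformly
distributed in `[-1, 1]`. -/
noncomputable def cubeMeasure : Measure Cube := Measure.infinitePi (fun _ : ℕ => uniformI)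

instance : IsProbabilityMeasure cubeMeasure :=
  inferInstanceAs (IsProbabilityMeasure (Measure.infinitePi (fun _ : ℕ => uniformI)))

/-- The function `f(z) = ∑ a_k z^k`; the series converges (at least) for `|z| < 1`. -/
noncomputable def seriesFun (a : Cube) (z : ℂ) : ℂ := ∑' k : ℕ, ((a k : ℝ) : ℂ) * z ^ k

/-- The number of zeros in `D`, counted with multiplicity, of a function `g` which is analytic at
every point of `D`. It is `⊤` when there are infinitely many zeros, or when `g` vanishes identically
near a point of `D`. -/
noncomputable def zeroCount (g : ℂ → ℂ) (D : Set ℂ) : ℕ∞ :=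
  ⨆ s : {s : Finset ℂ // (s : Set ℂ) ⊆ D}, ∑ z ∈ s.1, analyticOrderAt g z

/-- `𝒵_d(f)` on `D`: the supremum, over all `p_0, …, p_d ∈ ℂ[z]` of degree at most `d` which are not
all zero, of the number of zeros in `D` of `∑_{j ≤ d} p_j(z) f(z)^j`, counted with multiplicity. -/
noncomputable def bezoutNumber (f : ℂ → ℂ) (D : Set ℂ) (d : ℕ) : ℕ∞ :=
  ⨆ p : {p : Fin (d + 1) → ℂ[X] // (∀ j, (p j).natDegree ≤ d) ∧ p ≠ 0},
    zeroCount (fun z => ∑ j : Fin (d + 1), (p.1 j).eval z * f z ^ (j : ℕ)) D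

end RandomBezout

namespace RandomBezout

/-! A combination `g = ∑ p_j f ^ j` is determined by the `n = (d + 1) ^ 2` coefficients of the
`p_j`, and `coeffMatrix d` sends this vector to the first `n` Taylor coefficients of `g`. If `g` has
`N` zeros in the disc of radius `1/4`, dividing them out and applying the maximum principle on the
circle of radius `7/8` shows that `g` is at most `(4/5) ^ N` times its bound on that circle
(`norm_le_of_zeros`). By Cauchy's estimate its first `n` Taylor coefficients are then exponentially
small in `N`, and Cramer's rule (`norm_det_mul_norm_le`) makes the determinant small. So a lower
bound for the determinant bounds `N`, uniformly in the `p_j` (`bezoutNumber_le_of_det`).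

The determinant is a polynomial of degree at most `n * d` in each of the first `n` coordinates of
`a`, and it equals `1` at `f = z ^ (d + 1)`. A polynomial in one real variable is much smaller at
`t` than at a reference point only if `t` is near the real part of a root. Moving from `z ^ (d + 1)`
to a random point one coordinate at a time gives a lower bound with high probability
(`cubeMeasure_abs_lt_le`).

The failure probability `2 ^ (-(K + d))` is summable in `d`, so outside a set of measure at most `2
^ (-K)` all degrees are good at once. For fixed `K` the resulting count has order `d ^ 6`, which is
absorbed into `d ^ 8`. Letting `K` grow gives the almost sure statement; trimming a good set by a
threshold on `a 0` gives measure exactly `p`. -/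

/-! ### Counting zeros -/

/-- Zeros of a holomorphic function, listed in a multiset with at most their multiplicities, can be
divided out. -/
theorem exists_eq_prod_sub_mul {r : ℝ} (S : Multiset ℂ) :
    ∀ g : ℂ → ℂ, DifferentiableOn ℂ g (Metric.ball 0 r) → (∀ z ∈ S, z ∈ Metric.ball (0 : ℂ) r) →
      (∀ z ∈ S, (S.count z : ℕ∞) ≤ analyticOrderAt g z) →
      ∃ h : ℂ → ℂ, DifferentiableOn ℂ h (Metric.ball 0 r) ∧
        ∀ z, g z = (S.map (fun w => z - w)).prod * h z := by
  classical
  induction S using Multiset.induction_on with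
  | empty => exact fun g hg _ _ => ⟨g, hg, by simp⟩
  | cons a S ih =>
    intro g hg hS hord
    have ha : a ∈ Metric.ball (0 : ℂ) r := hS a (Multiset.mem_cons_self a S)
    have hnhds : ∀ {z : ℂ}, z ∈ Metric.ball (0 : ℂ) r → Metric.ball (0 : ℂ) r ∈ 𝓝 z :=
      fun hz => Metric.isOpen_ball.mem_nhds hz
    have hga : g a = 0 := by
      by_contra hne
      have h0 := (hg.analyticAt (hnhds ha)).analyticOrderAt_eq_zero.2 hne
      have h1 := hord a (Multiset.mem_cons_self a S)
      rw [h0, Multiset.count_cons_self] at h1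
      simp at h1
    have hfac : ∀ z, g z = (z - a) * dslope g a z := fun z => by
      have := sub_smul_dslope g a z
      rw [hga, sub_zero, smul_eq_mul] at this
      exact this.symm
    have hd : DifferentiableOn ℂ (dslope g a) (Metric.ball 0 r) :=
      (Complex.differentiableOn_dslope (hnhds ha)).2 hg
    obtain ⟨h, hh, hprod⟩ := ih (dslope g a) hd
      (fun z hz => hS z (Multiset.mem_cons_of_mem hz)) (fun z hz => by
        have hzb := hS z (Multiset.mem_cons_of_mem hz)
        have hlin : AnalyticAt ℂ (fun z : ℂ => z - a) z := by fun_prop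
        have hmul : analyticOrderAt g z =
            analyticOrderAt (fun z : ℂ => z - a) z + analyticOrderAt (dslope g a) z := by
          rw [← analyticOrderAt_mul hlin (hd.analyticAt (hnhds hzb))]
          congr 1
          exact funext hfac
        have hle := hord z (Multiset.mem_cons_of_mem hz)
        rw [hmul] at hle
        -- The factor `z - a` uses up one unit of the order at `a` and none elsewhere, matching the
        -- drop in `count`.
        by_cases hza : z = a
        · subst hza
          have hone : analyticOrderAt (fun w : ℂ => w - z) z = 1 := by
            have := (hlin.analyticOrderAt_eq_natCast (n := 1)).2
              ⟨fun _ => 1, analyticAt_const, one_ne_zero, by simp⟩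
            exact_mod_cast this
          rw [hone, Multiset.count_cons_self, Nat.cast_add, Nat.cast_one, add_comm] at hle
          exact (ENat.add_le_add_iff_left ENat.one_ne_top).1 hle
        · have hzero : analyticOrderAt (fun w : ℂ => w - a) z = 0 :=
            hlin.analyticOrderAt_eq_zero.2 (sub_ne_zero.2 hza)
          rwa [hzero, zero_add, Multiset.count_cons_of_ne hza] at hle)
    refine ⟨h, hh, fun z => ?_⟩
    rw [hfac, hprod, Multiset.map_cons, Multiset.prod_cons, mul_assoc]

theorem norm_prod_sub_le (S : Multiset ℂ) {z : ℂ} {c : ℝ} (h : ∀ w ∈ S, ‖z - w‖ ≤ c) :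
    ‖(S.map (fun w => z - w)).prod‖ ≤ c ^ S.card := by
  induction S using Multiset.induction_on with
  | empty => simp
  | cons a S ih =>
    rw [Multiset.map_cons, Multiset.prod_cons, norm_mul, Multiset.card_cons, pow_succ']
    have ha := h a (Multiset.mem_cons_self a S)
    exact mul_le_mul ha (ih fun w hw => h w (Multiset.mem_cons_of_mem hw)) (norm_nonneg _)
      ((norm_nonneg _).trans ha)

theorem le_norm_prod_sub (S : Multiset ℂ) {z : ℂ} {c : ℝ} (hc : 0 ≤ c)
    (h : ∀ w ∈ S, c ≤ ‖z - w‖) : c ^ S.card ≤ ‖(S.map (fun w => z - w)).prod‖ := by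
  induction S using Multiset.induction_on with
  | empty => simp
  | cons a S ih =>
    rw [Multiset.map_cons, Multiset.prod_cons, norm_mul, Multiset.card_cons, pow_succ']
    exact mul_le_mul (h a (Multiset.mem_cons_self a S))
      (ih fun w hw => h w (Multiset.mem_cons_of_mem hw)) (by positivity) (norm_nonneg _)

/-- A holomorphic function with many zeros in a small disc is small there. -/
theorem norm_le_of_zeros {g : ℂ → ℂ} {B : ℝ} (hg : DifferentiableOn ℂ g (Metric.ball 0 1))
    (hB : ∀ z ∈ Metric.sphere (0 : ℂ) (7 / 8), ‖g z‖ ≤ B) (S : Multiset ℂ)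
    (hS : ∀ z ∈ S, z ∈ Metric.closedBall (0 : ℂ) (1 / 4))
    (hord : ∀ z ∈ S, (S.count z : ℕ∞) ≤ analyticOrderAt g z) {z : ℂ}
    (hz : z ∈ Metric.closedBall (0 : ℂ) (1 / 4)) : ‖g z‖ ≤ B * (4 / 5) ^ S.card := by
  obtain ⟨h, hh, hfac⟩ := exists_eq_prod_sub_mul S g hg
    (fun w hw => Metric.closedBall_subset_ball (by norm_num) (hS w hw)) hord
  have hS' : ∀ w ∈ S, ‖w‖ ≤ 1 / 4 := fun w hw => by simpa using hS w hw
  have hz' : ‖z‖ ≤ 1 / 4 := by simpa using hz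
  have hsub : Metric.closedBall (0 : ℂ) (7 / 8) ⊆ Metric.ball 0 1 :=
    Metric.closedBall_subset_ball (by norm_num)
  -- Each zero is at distance at least `7/8 - 1/4 = 5/8` from the circle and at most `1/2` from `z`,
  -- whence the final ratio `(1/2) * (8/5) = 4/5`.
  have hsphere : ∀ w ∈ frontier (Metric.ball (0 : ℂ) (7 / 8)), ‖h w‖ ≤ B * (8 / 5) ^ S.card := by
    intro w hw
    rw [frontier_ball _ (by norm_num)] at hw
    have hw' : ‖w‖ = 7 / 8 := by simpa using hw
    have h1 := hB w hw
    rw [hfac, norm_mul] at h1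
    have h2 : (5 / 8 : ℝ) ^ S.card ≤ _ := le_norm_prod_sub S (z := w) (by norm_num) fun v hv => by
      have := norm_sub_norm_le w v
      have := hS' v hv
      linarith
    have h3 : (5 / 8 : ℝ) ^ S.card * ‖h w‖ ≤ B :=
      (mul_le_mul_of_nonneg_right h2 (norm_nonneg _)).trans h1
    calc ‖h w‖ = (5 / 8 : ℝ) ^ S.card * ‖h w‖ * (8 / 5) ^ S.card := by
          rw [mul_right_comm, ← mul_pow]; norm_num
      _ ≤ _ := mul_le_mul_of_nonneg_right h3 (by positivity)
  have hmax : ‖h z‖ ≤ B * (8 / 5) ^ S.card :=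
    Complex.norm_le_of_forall_mem_frontier_norm_le Metric.isBounded_ball
      ((hh.mono hsub).diffContOnCl_ball subset_rfl) hsphere
      (subset_closure (Metric.closedBall_subset_ball (by norm_num) hz))
  have hprod : ‖(S.map (fun w => z - w)).prod‖ ≤ (1 / 2) ^ S.card :=
    norm_prod_sub_le S fun w hw => by
      have := norm_sub_le z w
      have := hS' w hw
      linarith
  rw [hfac, norm_mul]
  calc _ ≤ (1 / 2 : ℝ) ^ S.card * (B * (8 / 5) ^ S.card) :=
        mul_le_mul hprod hmax (norm_nonneg _) (by positivity)
    _ = B * (4 / 5) ^ S.card := by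
      rw [mul_left_comm, ← mul_pow]; norm_num

/-- To bound `zeroCount` it suffices to bound the cardinality of multisets of zeros. -/
theorem zeroCount_le_of_multiset {g : ℂ → ℂ} {D : Set ℂ} {N : ℕ}
    (h : ∀ S : Multiset ℂ, (∀ z ∈ S, z ∈ D) →
      (∀ z ∈ S, (S.count z : ℕ∞) ≤ analyticOrderAt g z) → S.card ≤ N) :
    zeroCount g D ≤ N := by
  classical
  refine iSup_le fun s => ?_
  obtain ⟨s, hs⟩ := s
  have key : ∀ m : ℂ → ℕ, (∀ z, (m z : ℕ∞) ≤ analyticOrderAt g z) → ∑ z ∈ s, m z ≤ N := by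
    intro m hm
    have hcount : ∀ w, (∑ z ∈ s, Multiset.replicate (m z) z).count w ≤ m w := by
      intro w
      rw [Multiset.count_sum']
      simp only [Multiset.count_replicate]
      rw [Finset.sum_ite_eq' s w m]
      split_ifs <;> simp
    have := h (∑ z ∈ s, Multiset.replicate (m z) z) (fun z hz => by
        obtain ⟨i, hi, hzi⟩ := Multiset.mem_sum.1 hz
        rw [Multiset.eq_of_mem_replicate hzi]
        exact hs hi)
      (fun z _ => le_trans (by exact_mod_cast hcount z) (hm z))
    simpa using this
  -- A point of infinite order could be listed `N + 1` times, against `key`.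
  have hfin : ∀ z ∈ s, analyticOrderAt g z ≠ ⊤ := by
    intro z hz htop
    have := key (fun w => if w = z then N + 1 else 0) (fun w => by
      split_ifs with hw
      · subst hw; rw [htop]; exact le_top
      · simp)
    rw [Finset.sum_ite_eq' s z] at this
    simp [hz] at this
  have := key (fun z => (analyticOrderAt g z).toNat) (fun z => ENat.natCast_toNat_le_self _)
  calc ∑ z ∈ s, analyticOrderAt g z = ∑ z ∈ s, (((analyticOrderAt g z).toNat : ℕ) : ℕ∞) :=
        Finset.sum_congr rfl fun z hz => (ENat.natCast_toNat (hfin z hz)).symm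
    _ ≤ N := by exact_mod_cast this


/-! ### Power series and the functions they define on the unit disc -/

/-- The power series `P` converges absolutely to `g` on the open unit disc. -/
def IsSumOnDisc (P : PowerSeries ℂ) (g : ℂ → ℂ) : Prop :=
  ∀ z : ℂ, ‖z‖ < 1 → (Summable fun k => ‖PowerSeries.coeff k P * z ^ k‖) ∧
    ∑' k, PowerSeries.coeff k P * z ^ k = g z

theorem IsSumOnDisc.mul {P Q : PowerSeries ℂ} {f g : ℂ → ℂ} (hP : IsSumOnDisc P f)
    (hQ : IsSumOnDisc Q g) : IsSumOnDisc (P * Q) (fun z => f z * g z) := by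
  intro z hz
  obtain ⟨h1, h1'⟩ := hP z hz
  obtain ⟨h2, h2'⟩ := hQ z hz
  have hterm : (fun k => PowerSeries.coeff k (P * Q) * z ^ k) = fun k =>
      ∑ kl ∈ Finset.HasAntidiagonal.antidiagonal k,
        (PowerSeries.coeff kl.1 P * z ^ kl.1) * (PowerSeries.coeff kl.2 Q * z ^ kl.2) := by
    funext k
    rw [PowerSeries.coeff_mul, Finset.sum_mul]
    refine Finset.sum_congr rfl fun kl hkl => ?_
    rw [← Finset.HasAntidiagonal.mem_antidiagonal.1 hkl, pow_add]
    ring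
  constructor
  · have hsum := summable_norm_sum_mul_antidiagonal_of_summable_norm h1 h2
    have hnorm : ∀ k, ‖PowerSeries.coeff k (P * Q) * z ^ k‖ = _ :=
      fun k => congrArg norm (congrFun hterm k)
    simp only [hnorm]
    exact hsum
  · rw [hterm, ← tsum_mul_tsum_eq_tsum_sum_antidiagonal_of_summable_norm h1 h2, h1', h2']

theorem isSumOnDisc_polynomial (p : ℂ[X]) : IsSumOnDisc (p : PowerSeries ℂ) p.eval := by
  intro z _
  have h0 : ∀ k ∉ Finset.range (p.natDegree + 1),
      PowerSeries.coeff k (p : PowerSeries ℂ) * z ^ k = 0 := by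
    intro k hk
    rw [Polynomial.coeff_coe, Polynomial.coeff_eq_zero_of_natDegree_lt, zero_mul]
    rw [Finset.mem_range] at hk
    omega
  refine ⟨summable_of_ne_finset_zero (s := Finset.range (p.natDegree + 1))
    fun k hk => by rw [h0 k hk, norm_zero], ?_⟩
  rw [tsum_eq_sum h0]
  simp only [Polynomial.coeff_coe, Polynomial.eval_eq_sum_range]

theorem IsSumOnDisc.pow {P : PowerSeries ℂ} {f : ℂ → ℂ} (hP : IsSumOnDisc P f) (j : ℕ) :
    IsSumOnDisc (P ^ j) (fun z => f z ^ j) := by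
  induction j with
  | zero => simpa using isSumOnDisc_polynomial 1
  | succ j ih => simpa only [pow_succ] using ih.mul hP

theorem IsSumOnDisc.sum {ι : Type*} (s : Finset ι) {P : ι → PowerSeries ℂ} {f : ι → ℂ → ℂ}
    (hP : ∀ i ∈ s, IsSumOnDisc (P i) (f i)) :
    IsSumOnDisc (∑ i ∈ s, P i) (fun z => ∑ i ∈ s, f i z) := by
  intro z hz
  have hterm : (fun k => PowerSeries.coeff k (∑ i ∈ s, P i) * z ^ k) = fun k =>
      ∑ i ∈ s, PowerSeries.coeff k (P i) * z ^ k := by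
    funext k
    rw [map_sum, Finset.sum_mul]
  rw [hterm]
  constructor
  · refine Summable.of_nonneg_of_le (fun _ => norm_nonneg _) (fun k => (congrArg _ (congrFun hterm k)).trans_le (norm_sum_le _ _))
      (summable_sum fun i hi => (hP i hi z hz).1)
  · rw [Summable.tsum_finsetSum fun i hi => (hP i hi z hz).1.of_norm]
    exact Finset.sum_congr rfl fun i hi => (hP i hi z hz).2

theorem IsSumOnDisc.hasFPowerSeriesOnBall {P : PowerSeries ℂ} {g : ℂ → ℂ}
    (h : IsSumOnDisc P g) :
    HasFPowerSeriesOnBall g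
      (FormalMultilinearSeries.ofScalars ℂ fun k => PowerSeries.coeff k P) 0 1 where
  r_le := by
    refine ENNReal.le_of_forall_nnreal_lt fun r hr => ?_
    have hr' : (r : ℝ) < 1 := by exact_mod_cast hr
    refine FormalMultilinearSeries.le_radius_of_summable_norm _ ?_
    have := (h (r : ℂ) (by simpa using hr')).1
    simpa [FormalMultilinearSeries.ofScalars_norm] using this
  r_pos := by norm_num
  hasSum := by
    intro y hy
    have hy' : ‖y‖ < 1 := by
      rw [Metric.mem_eball, edist_zero_right, ← ofReal_norm] at hy
      exact ENNReal.ofReal_lt_one.1 hy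
    obtain ⟨h1, h2⟩ := h y hy'
    have := h1.of_norm.hasSum
    rw [h2] at this
    simpa [FormalMultilinearSeries.ofScalars_apply_eq, mul_comm] using this

theorem IsSumOnDisc.differentiableOn {P : PowerSeries ℂ} {g : ℂ → ℂ} (h : IsSumOnDisc P g) :
    DifferentiableOn ℂ g (Metric.ball 0 1) := by
  have := h.hasFPowerSeriesOnBall.differentiableOn
  rwa [← ENNReal.ofReal_one, Metric.eball_ofReal] at this

/-- Cauchy's estimate for the coefficients. -/
theorem IsSumOnDisc.norm_coeff_le {P : PowerSeries ℂ} {g : ℂ → ℂ} (h : IsSumOnDisc P g)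
    {r M : ℝ} (hr : 0 < r) (hr1 : r < 1) (hM : ∀ z ∈ Metric.sphere (0 : ℂ) r, ‖g z‖ ≤ M) (k : ℕ) :
    ‖PowerSeries.coeff k P‖ ≤ M / r ^ k := by
  have h1 := Complex.norm_iteratedDeriv_le_of_forall_mem_sphere_norm_le k hr
    ((h.differentiableOn.mono (Metric.closedBall_subset_ball hr1)).diffContOnCl_ball subset_rfl) hM
  have h2 := h.hasFPowerSeriesOnBall.factorial_smul 1 k
  rw [← iteratedDeriv_eq_iteratedFDeriv, FormalMultilinearSeries.ofScalars_apply_eq] at h2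
  rw [← h2, nsmul_eq_mul, norm_mul, mul_div_assoc, Complex.norm_natCast] at h1
  have h3 := le_of_mul_le_mul_left h1 (by exact_mod_cast k.factorial_pos)
  simpa using h3


/-! ### A Remez type inequality in one variable -/

/-- Factor by factor, `‖t₀ - z‖ ≤ ‖t - z‖ + 2 ≤ (1 + 2 / r) * ‖t - z‖`. -/
theorem le_norm_prod_sub_of_forall_le (S : Multiset ℂ) {r t t₀ : ℝ} (hr : 0 < r)
    (ht : |t - t₀| ≤ 2) (h : ∀ z ∈ S, r ≤ ‖(t : ℂ) - z‖) :
    (r / (r + 2)) ^ S.card * ‖(S.map fun z => (t₀ : ℂ) - z).prod‖ ≤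
      ‖(S.map fun z => (t : ℂ) - z).prod‖ := by
  induction S using Multiset.induction_on with
  | empty => simp
  | cons a S ih =>
    simp only [Multiset.map_cons, Multiset.prod_cons, norm_mul, Multiset.card_cons, pow_succ']
    have hfac : r / (r + 2) * ‖(t₀ : ℂ) - a‖ ≤ ‖(t : ℂ) - a‖ := by
      have h1 := h a (Multiset.mem_cons_self a S)
      have h2 : ‖(t₀ : ℂ) - a‖ ≤ ‖(t : ℂ) - a‖ + 2 := by
        have h3 := norm_sub_le ((t : ℂ) - a) ((t : ℂ) - t₀)
        rw [← Complex.ofReal_sub, Complex.norm_real, Real.norm_eq_abs] at h3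
        have h4 : (t : ℂ) - a - ((t - t₀ : ℝ) : ℂ) = t₀ - a := by push_cast; ring
        rw [h4] at h3
        linarith
      rw [div_mul_eq_mul_div, div_le_iff₀ (by positivity)]
      nlinarith
    calc _ = (r / (r + 2) * ‖(t₀ : ℂ) - a‖) *
          ((r / (r + 2)) ^ S.card * ‖(S.map fun z => (t₀ : ℂ) - z).prod‖) := by ring
      _ ≤ _ := mul_le_mul hfac (ih fun z hz => h z (Multiset.mem_cons_of_mem hz))
        (by positivity) (norm_nonneg _)

/-- A real polynomial is not much smaller at `t` than at `t₀`, unless `t` is close to the real part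
of one of its complex roots. -/
theorem exists_root_of_eval_lt {q : ℝ[X]} {D : ℕ} (hq : q.natDegree ≤ D) {r t t₀ : ℝ} (hr : 0 < r)
    (ht : |t - t₀| ≤ 2) (hlt : |q.eval t| < (r / (r + 2)) ^ D * |q.eval t₀|) :
    ∃ z ∈ (q.map (algebraMap ℝ ℂ)).roots, t ∈ Set.Icc (z.re - r) (z.re + r) := by
  by_contra! hno
  have hsplit : (q.map (algebraMap ℝ ℂ)).Splits := IsAlgClosed.splits _
  have heval : ∀ x : ℝ, |q.eval x| = ‖(q.map (algebraMap ℝ ℂ)).leadingCoeff‖ *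
      ‖((q.map (algebraMap ℝ ℂ)).roots.map fun z => (x : ℂ) - z).prod‖ := by
    intro x
    rw [← norm_mul, ← hsplit.eval_eq_prod_roots, ← Real.norm_eq_abs, ← Complex.norm_real]
    congr 1
    exact (Polynomial.eval_map_apply (algebraMap ℝ ℂ) x).symm
  have hfar : ∀ z ∈ (q.map (algebraMap ℝ ℂ)).roots, r ≤ ‖(t : ℂ) - z‖ := by
    intro z hz
    by_contra! hlt
    have h1 : |((t : ℂ) - z).re| < r := (Complex.abs_re_le_norm _).trans_lt hlt
    rw [Complex.sub_re, Complex.ofReal_re, abs_lt] at h1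
    exact hno z hz ⟨by linarith, by linarith⟩
  have hmain := le_norm_prod_sub_of_forall_le _ hr ht hfar
  have hcard : (q.map (algebraMap ℝ ℂ)).roots.card ≤ D :=
    ((Polynomial.card_roots' _).trans (Polynomial.natDegree_map_le)).trans hq
  have hpow : (r / (r + 2)) ^ D ≤ (r / (r + 2)) ^ (q.map (algebraMap ℝ ℂ)).roots.card :=
    pow_le_pow_of_le_one (by positivity) (by rw [div_le_one (by positivity)]; linarith) hcard
  refine hlt.not_ge ?_
  rw [heval t, heval t₀, mul_left_comm]
  exact mul_le_mul_of_nonneg_left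
    ((mul_le_mul_of_nonneg_right hpow (norm_nonneg _)).trans hmain) (norm_nonneg _)

theorem uniformI_apply (S : Set I) : uniformI S = 2⁻¹ * volume (Subtype.val '' S) := by
  rw [uniformI, Measure.smul_apply, smul_eq_mul,
    (MeasurableEmbedding.subtype_coe measurableSet_Icc).comap_apply]

/-- The bad parameters lie in at most `D` intervals of length `2 * r` around real parts of roots;
normalizing the measure halves their total length. -/
theorem uniformI_eval_lt_le {q : ℝ[X]} {D : ℕ} (hq : q.natDegree ≤ D) {r : ℝ} (hr : 0 < r)
    (t₀ : I) :
    uniformI {t : I | |q.eval (t : ℝ)| < (r / (r + 2)) ^ D * |q.eval (t₀ : ℝ)|} ≤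
      ENNReal.ofReal (D * r) := by
  set R := (q.map (algebraMap ℝ ℂ)).roots with hR
  have hsub : Subtype.val '' {t : I | |q.eval (t : ℝ)| < (r / (r + 2)) ^ D * |q.eval (t₀ : ℝ)|} ⊆
      ⋃ z ∈ R.toFinset, Set.Icc (z.re - r) (z.re + r) := by
    rintro _ ⟨t, ht, rfl⟩
    have habs : |(t : ℝ) - t₀| ≤ 2 := by
      have h1 := t.2
      have h2 := t₀.2
      rw [Set.mem_Icc] at h1 h2
      rw [abs_le]
      constructor <;> linarith
    obtain ⟨z, hz, hzt⟩ := exists_root_of_eval_lt hq hr habs ht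
    exact Set.mem_biUnion (Multiset.mem_toFinset.2 hz) hzt
  have hcard : R.toFinset.card ≤ D := (Multiset.toFinset_card_le R).trans
    (((Polynomial.card_roots' _).trans (Polynomial.natDegree_map_le)).trans hq)
  have hvol : volume (⋃ z ∈ R.toFinset, Set.Icc (z.re - r) (z.re + r)) ≤
      D * ENNReal.ofReal (2 * r) := by
    refine (measure_biUnion_finset_le _ _).trans ?_
    calc ∑ z ∈ R.toFinset, volume (Set.Icc (z.re - r) (z.re + r))
        = ∑ z ∈ R.toFinset, ENNReal.ofReal (2 * r) := by
          refine Finset.sum_congr rfl fun z _ => ?_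
          rw [Real.volume_Icc]
          congr 1
          ring
      _ = R.toFinset.card * ENNReal.ofReal (2 * r) := by rw [Finset.sum_const, nsmul_eq_mul]
      _ ≤ _ := by gcongr
  rw [uniformI_apply]
  calc _ ≤ 2⁻¹ * (D * ENNReal.ofReal (2 * r)) := by
        gcongr
        exact (measure_mono hsub).trans hvol
    _ = ENNReal.ofReal (D * r) := by
      rw [ENNReal.ofReal_mul (by norm_num), ENNReal.ofReal_mul (by positivity),
        ENNReal.ofReal_natCast, mul_left_comm (D : ℝ≥0∞), ← mul_assoc, ENNReal.ofReal_ofNat,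
        ENNReal.inv_mul_cancel (by norm_num) (by norm_num), one_mul]

/-! ### Resampling one coordinate -/

/-- Both measures agree on finite-dimensional boxes, which determine a product measure. -/
theorem cubeMeasure_eq_map_update (k : ℕ) :
    (cubeMeasure.prod uniformI).map (fun x : Cube × I => Function.update x.1 k x.2) =
      cubeMeasure := by
  have hmeas : Measurable fun x : Cube × I => Function.update x.1 k x.2 := by
    refine measurable_pi_lambda _ fun i => ?_
    by_cases hi : i = k
    · subst hi
      simpa using measurable_snd
    · simp only [Function.update_of_ne hi]
      fun_prop
  refine Measure.eq_infinitePi _ fun s T hT => ?_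
  rw [Measure.map_apply hmeas (MeasurableSet.pi s.countable_toSet fun i _ => hT i)]
  by_cases hk : k ∈ s
  · have hpre : (fun x : Cube × I => Function.update x.1 k x.2) ⁻¹' ((s : Set ℕ).pi T) =
        ((s.erase k : Finset ℕ) : Set ℕ).pi T ×ˢ T k := by
      ext ⟨a, t⟩
      simp only [Set.mem_preimage, Set.mem_pi, Finset.mem_coe, Set.mem_prod, Finset.mem_erase]
      constructor
      · intro h
        exact ⟨fun i hi => by simpa [Function.update_of_ne hi.1] using h i hi.2,
          by simpa using h k hk⟩
      · rintro ⟨h1, h2⟩ i hi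
        by_cases hik : i = k
        · subst hik; simpa using h2
        · simpa [Function.update_of_ne hik] using h1 i ⟨hik, hi⟩
    rw [hpre, Measure.prod_prod, cubeMeasure, Measure.infinitePi_pi _ fun i _ => hT i,
      Finset.prod_erase_mul _ _ hk]
  · have hpre : (fun x : Cube × I => Function.update x.1 k x.2) ⁻¹' ((s : Set ℕ).pi T) =
        (s : Set ℕ).pi T ×ˢ Set.univ := by
      ext ⟨a, t⟩
      simp only [Set.mem_preimage, Set.mem_pi, Finset.mem_coe, Set.mem_prod, Set.mem_univ,
        and_true]
      refine forall₂_congr fun i hi => ?_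
      have hik : i ≠ k := fun h => hk (h ▸ hi)
      rw [Function.update_of_ne hik]
    rw [hpre, Measure.prod_prod, measure_univ, mul_one, cubeMeasure,
      Measure.infinitePi_pi _ fun i _ => hT i]

/-- Fubini after resampling: a bound on one-dimensional slices, uniform in the other coordinates,
bounds the whole set. -/
theorem cubeMeasure_le_of_forall_update (k : ℕ) {B : Set Cube} (hB : MeasurableSet B) {κ : ℝ≥0∞}
    (h : ∀ a : Cube, uniformI {t | Function.update a k t ∈ B} ≤ κ) : cubeMeasure B ≤ κ := by
  have hmeas : Measurable fun x : Cube × I => Function.update x.1 k x.2 := by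
    refine measurable_pi_lambda _ fun i => ?_
    by_cases hi : i = k
    · subst hi
      simpa using measurable_snd
    · simp only [Function.update_of_ne hi]
      fun_prop
  rw [← cubeMeasure_eq_map_update k, Measure.map_apply hmeas hB, Measure.prod_apply (hmeas hB)]
  calc _ ≤ ∫⁻ _ : Cube, κ ∂cubeMeasure := lintegral_mono fun a => h a
    _ = κ := by simp

/-! ### Functions that are polynomial in each coordinate -/

/-- As a function of any single coordinate, `g` is a polynomial of degree at most `D`. -/
def IsCoordPoly (D : ℕ) (g : (ℕ → ℝ) → ℝ) : Prop :=
  ∀ (a : ℕ → ℝ) (k : ℕ), ∃ q : ℝ[X], q.natDegree ≤ D ∧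
    ∀ t, g (Function.update a k t) = q.eval t

theorem IsCoordPoly.mono {D D' : ℕ} {g : (ℕ → ℝ) → ℝ} (h : IsCoordPoly D g) (hD : D ≤ D') :
    IsCoordPoly D' g := fun a k =>
  let ⟨q, hq, hqe⟩ := h a k
  ⟨q, hq.trans hD, hqe⟩

theorem isCoordPoly_const (D : ℕ) (c : ℝ) : IsCoordPoly D fun _ => c :=
  fun _ _ => ⟨Polynomial.C c, by simp, by simp⟩

theorem isCoordPoly_apply (i : ℕ) : IsCoordPoly 1 fun a => a i := fun a k => by
  by_cases h : i = k
  · exact ⟨Polynomial.X, by simp, by simp [h]⟩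
  · exact ⟨Polynomial.C (a i), by simp, by simp [h]⟩

theorem IsCoordPoly.mul {D D' : ℕ} {g g' : (ℕ → ℝ) → ℝ} (h : IsCoordPoly D g)
    (h' : IsCoordPoly D' g') : IsCoordPoly (D + D') fun a => g a * g' a := fun a k => by
  obtain ⟨q, hq, hqe⟩ := h a k
  obtain ⟨q', hq', hqe'⟩ := h' a k
  exact ⟨q * q', Polynomial.natDegree_mul_le_of_le hq hq', fun t => by simp [hqe, hqe']⟩

theorem IsCoordPoly.sum {ι : Type*} (s : Finset ι) {D : ℕ} {g : ι → (ℕ → ℝ) → ℝ}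
    (h : ∀ i ∈ s, IsCoordPoly D (g i)) : IsCoordPoly D fun a => ∑ i ∈ s, g i a := fun a k => by
  choose! q hq hqe using fun i (hi : i ∈ s) => h i hi a k
  refine ⟨∑ i ∈ s, q i, Polynomial.natDegree_sum_le_of_forall_le s q hq, fun t => ?_⟩
  rw [Polynomial.eval_finsetSum]
  exact Finset.sum_congr rfl fun i hi => hqe i hi t

theorem IsCoordPoly.prod {ι : Type*} (s : Finset ι) {D : ℕ} {g : ι → (ℕ → ℝ) → ℝ}
    (h : ∀ i ∈ s, IsCoordPoly D (g i)) : IsCoordPoly (s.card * D) fun a => ∏ i ∈ s, g i a := by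
  classical
  induction s using Finset.induction_on with
  | empty => simpa using isCoordPoly_const 0 1
  | insert i s hi ih =>
    simp only [Finset.prod_insert hi, Finset.card_insert_of_notMem hi]
    refine ((h i (Finset.mem_insert_self i s)).mul
      (ih fun j hj => h j (Finset.mem_insert_of_mem hj))).mono (le_of_eq ?_)
    ring

theorem IsCoordPoly.det {ι : Type*} [Fintype ι] [DecidableEq ι] {D : ℕ}
    {M : (ℕ → ℝ) → Matrix ι ι ℝ} (h : ∀ i j, IsCoordPoly D fun a => M a i j) :
    IsCoordPoly (Fintype.card ι * D) fun a => (M a).det := by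
  simp only [Matrix.det_apply']
  refine IsCoordPoly.sum _ fun σ _ => ?_
  have := (isCoordPoly_const 0 ((Equiv.Perm.sign σ : ℤ) : ℝ)).mul
    (IsCoordPoly.prod Finset.univ fun i _ => h (σ i) i)
  rwa [zero_add] at this

/-- The real sequence underlying a point of the cube. -/
def toReal (a : Cube) : ℕ → ℝ := fun k => a k

/-- The point with the coordinates of `a` before `k`, and those of `b` from `k` on. -/
def splice (b : Cube) (k : ℕ) (a : Cube) : Cube := fun i => if i < k then a i else b i

theorem toReal_update (a : Cube) (k : ℕ) (t : I) :
    toReal (Function.update a k t) = Function.update (toReal a) k (t : ℝ) := by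
  funext i
  by_cases h : i = k
  · subst h; simp [toReal]
  · simp [toReal, h]

theorem continuous_toReal : Continuous toReal :=
  continuous_pi fun i => continuous_subtype_val.comp (continuous_apply i)

theorem continuous_splice (b : Cube) (k : ℕ) : Continuous (splice b k) := by
  refine continuous_pi fun i => ?_
  unfold splice
  split_ifs
  · exact continuous_apply i
  · exact continuous_const

theorem splice_succ_update (a b : Cube) (k : ℕ) (t : I) :
    splice b (k + 1) (Function.update a k t) = Function.update (splice b k a) k t := by
  funext i
  rcases lt_trichotomy i k with h | h | h
  · simp [splice, h, h.ne, Nat.lt_succ_of_lt h]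
  · subst h; simp [splice]
  · have h1 : ¬ i < k + 1 := by omega
    simp [splice, h.ne', h.not_gt, h1]

theorem splice_update (a b : Cube) (k : ℕ) (t : I) :
    splice b k (Function.update a k t) = splice b k a := by
  funext i
  by_cases h : i < k
  · simp [splice, h, h.ne]
  · simp [splice, h]

/-- A function that is polynomial in each of finitely many coordinates and not small somewhere on
the cube is small only with small probability. -/
theorem cubeMeasure_abs_lt_le {D n : ℕ} {g : (ℕ → ℝ) → ℝ} (hg : IsCoordPoly D g)
    (hcont : Continuous g) (hdep : ∀ a b : ℕ → ℝ, (∀ i < n, a i = b i) → g a = g b)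
    (b : Cube) (hb : 1 ≤ |g (toReal b)|) {r : ℝ} (hr : 0 < r) :
    cubeMeasure {a | |g (toReal a)| < (r / (r + 2)) ^ (D * n)} ≤ ENNReal.ofReal (n * (D * r)) := by
  set c := r / (r + 2) with hc
  have hc0 : 0 < c := by positivity
  have hcg : ∀ k, Continuous fun a : Cube => |g (toReal (splice b k a))| := fun k =>
    (hcont.comp (continuous_toReal.comp (continuous_splice b k))).abs
  have key : ∀ k : ℕ, cubeMeasure {a | |g (toReal (splice b k a))| < c ^ (D * k)} ≤
      ENNReal.ofReal (k * (D * r)) := by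
    intro k
    induction k with
    | zero =>
      have : {a : Cube | |g (toReal (splice b 0 a))| < c ^ (D * 0)} = ∅ := by
        ext a
        have : splice b 0 a = b := by funext i; simp [splice]
        simpa [this] using hb
      rw [this]
      simp
    | succ k ih =>
      have hstep : cubeMeasure {a : Cube | |g (toReal (splice b (k + 1) a))| <
          c ^ D * |g (toReal (splice b k a))|} ≤ ENNReal.ofReal (D * r) := by
        refine cubeMeasure_le_of_forall_update k
          (measurableSet_lt (hcg (k + 1)).measurable ((hcg k).measurable.const_mul _)) fun a => ?_
        obtain ⟨q, hq, hqe⟩ := hg (toReal (splice b k a)) k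
        -- The reference value is the same one-variable polynomial at `b k`, so passing from `k` to
        -- `k + 1` only replaces `b k` by the random coordinate.
        have hbase : g (toReal (splice b k a)) = q.eval (b k : ℝ) := by
          rw [← hqe]
          congr 1
          rw [← toReal_update]
          congr 1
          funext i
          by_cases h : i = k
          · subst h; simp [splice]
          · simp [h]
        have hset : {t : I | Function.update a k t ∈ {a : Cube |
            |g (toReal (splice b (k + 1) a))| < c ^ D * |g (toReal (splice b k a))|}} =
            {t : I | |q.eval (t : ℝ)| < c ^ D * |q.eval (b k : ℝ)|} := by
          ext t
          simp only [Set.mem_ofPred_eq, splice_succ_update, splice_update, toReal_update, hqe, hbase]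
        rw [hset]
        exact uniformI_eval_lt_le hq hr (b k)
      have hsub : {a : Cube | |g (toReal (splice b (k + 1) a))| < c ^ (D * (k + 1))} ⊆
          {a | |g (toReal (splice b k a))| < c ^ (D * k)} ∪
          {a : Cube | |g (toReal (splice b (k + 1) a))| <
            c ^ D * |g (toReal (splice b k a))|} := by
        intro a ha
        simp only [Set.mem_union, Set.mem_ofPred_eq] at ha ⊢
        by_contra! hcon
        refine ha.not_ge (le_trans ?_ hcon.2)
        rw [mul_add, mul_one, pow_add, mul_comm]
        exact mul_le_mul_of_nonneg_left hcon.1 (by positivity)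
      calc _ ≤ _ := (measure_mono hsub).trans (measure_union_le _ _)
        _ ≤ ENNReal.ofReal (k * (D * r)) + ENNReal.ofReal (D * r) := add_le_add ih hstep
        _ = _ := by
          rw [← ENNReal.ofReal_add (by positivity) (by positivity)]
          congr 1
          push_cast
          ring
  have hfin : ∀ a : Cube, g (toReal (splice b n a)) = g (toReal a) := fun a =>
    hdep _ _ fun i hi => by simp [toReal, splice, hi]
  simpa only [hfin] using key n


/-! ### The coefficient matrix -/

theorem isCoordPoly_coeff_pow (j m : ℕ) :
    IsCoordPoly j fun a => PowerSeries.coeff m (PowerSeries.mk a ^ j) := by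
  induction j generalizing m with
  | zero => simpa using isCoordPoly_const 0 _
  | succ j ih =>
    simp only [pow_succ, PowerSeries.coeff_mul, PowerSeries.coeff_mk]
    exact IsCoordPoly.sum _ fun l _ => (ih l.1).mul (isCoordPoly_apply l.2)

theorem continuous_coeff_pow (j m : ℕ) :
    Continuous fun a : ℕ → ℝ => PowerSeries.coeff m (PowerSeries.mk a ^ j) := by
  induction j generalizing m with
  | zero => simpa using continuous_const
  | succ j ih =>
    simp only [pow_succ, PowerSeries.coeff_mul, PowerSeries.coeff_mk]
    exact continuous_finsetSum _ fun l _ => (ih l.1).mul (continuous_apply l.2)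

theorem coeff_pow_congr {a b : ℕ → ℝ} (j m : ℕ) (h : ∀ i ≤ m, a i = b i) :
    PowerSeries.coeff m (PowerSeries.mk a ^ j) = PowerSeries.coeff m (PowerSeries.mk b ^ j) := by
  induction j generalizing m with
  | zero => simp
  | succ j ih =>
    simp only [pow_succ, PowerSeries.coeff_mul, PowerSeries.coeff_mk]
    refine Finset.sum_congr rfl fun l hl => ?_
    have hl' := Finset.HasAntidiagonal.mem_antidiagonal.1 hl
    rw [ih l.1 fun i hi => h i (by omega), h l.2 (by omega)]

theorem abs_coeff_pow_le {a : ℕ → ℝ} (ha : ∀ i, |a i| ≤ 1) (j m : ℕ) :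
    |PowerSeries.coeff m (PowerSeries.mk a ^ j)| ≤ ((m : ℝ) + 1) ^ j := by
  induction j generalizing m with
  | zero =>
    rw [pow_zero, PowerSeries.coeff_one]
    split_ifs <;> simp
  | succ j ih =>
    simp only [pow_succ, PowerSeries.coeff_mul, PowerSeries.coeff_mk]
    refine (Finset.abs_sum_le_sum_abs _ _).trans ?_
    calc _ ≤ ∑ l ∈ Finset.HasAntidiagonal.antidiagonal m, ((m : ℝ) + 1) ^ j := by
          refine Finset.sum_le_sum fun l hl => ?_
          have hl' : l.1 ≤ m := by
            have := Finset.HasAntidiagonal.mem_antidiagonal.1 hl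
            omega
          rw [abs_mul]
          calc _ ≤ ((l.1 : ℝ) + 1) ^ j * 1 :=
                mul_le_mul (ih l.1) (ha l.2) (abs_nonneg _) (by positivity)
            _ ≤ _ := by
              rw [mul_one]
              gcongr
      _ = _ := by
        rw [Finset.sum_const, Finset.Nat.card_antidiagonal, nsmul_eq_mul]
        push_cast
        ring

/-- Row and column indices: pairs `(i, j)` with `i, j ≤ d`. -/
abbrev Idx (d : ℕ) : Type := Fin (d + 1) × Fin (d + 1)

/-- The degree `i + (d + 1) j` attached to the pair `(i, j)`. -/
def Idx.deg {d : ℕ} (s : Idx d) : ℕ := s.1 + (d + 1) * s.2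

theorem Idx.deg_lt {d : ℕ} (s : Idx d) : s.deg < (d + 1) ^ 2 := by
  have h1 := s.1.2
  have h2 : (s.2 : ℕ) ≤ d := Nat.lt_succ_iff.1 s.2.2
  unfold Idx.deg
  nlinarith

theorem Idx.deg_injective {d : ℕ} : Function.Injective (Idx.deg (d := d)) := by
  intro s t h
  unfold Idx.deg at h
  have h1 := congrArg (· % (d + 1)) h
  have h2 := congrArg (· / (d + 1)) h
  simp only [Nat.add_mul_mod_self_left, Nat.mod_eq_of_lt s.1.2, Nat.mod_eq_of_lt t.1.2] at h1
  simp only [Nat.add_mul_div_left _ _ (Nat.succ_pos d), Nat.div_eq_of_lt s.1.2,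
    Nat.div_eq_of_lt t.1.2, zero_add] at h2
  exact Prod.ext (Fin.ext h1) (Fin.ext h2)

theorem Idx.card (d : ℕ) : Fintype.card (Idx d) = (d + 1) ^ 2 := by
  simp [sq]

/-- The first `(d + 1) ^ 2` Taylor coefficients of the functions `z ^ i * f z ^ j`, `i, j ≤ d`. -/
noncomputable def coeffMatrix (d : ℕ) (a : ℕ → ℝ) : Matrix (Idx d) (Idx d) ℝ :=
  Matrix.of fun s t => PowerSeries.coeff s.deg
    ((PowerSeries.X : PowerSeries ℝ) ^ (t.1 : ℕ) * PowerSeries.mk a ^ (t.2 : ℕ))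

theorem coeffMatrix_apply (d : ℕ) (a : ℕ → ℝ) (s t : Idx d) :
    coeffMatrix d a s t = if (t.1 : ℕ) ≤ s.deg then
      PowerSeries.coeff (s.deg - t.1) (PowerSeries.mk a ^ (t.2 : ℕ)) else 0 :=
  PowerSeries.coeff_X_pow_mul' _ _ _

theorem isCoordPoly_det_coeffMatrix (d : ℕ) :
    IsCoordPoly ((d + 1) ^ 2 * d) fun a => (coeffMatrix d a).det := by
  rw [← Idx.card]
  refine IsCoordPoly.det fun s t => ?_
  simp only [coeffMatrix_apply]
  split_ifs
  · exact (isCoordPoly_coeff_pow _ _).mono (Nat.lt_succ_iff.1 t.2.2)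
  · exact isCoordPoly_const _ _

theorem continuous_det_coeffMatrix (d : ℕ) : Continuous fun a => (coeffMatrix d a).det := by
  refine Continuous.matrix_det (continuous_matrix fun s t => ?_)
  simp only [coeffMatrix_apply]
  split_ifs
  · exact continuous_coeff_pow _ _
  · exact continuous_const

theorem det_coeffMatrix_congr (d : ℕ) {a b : ℕ → ℝ} (h : ∀ i < (d + 1) ^ 2, a i = b i) :
    (coeffMatrix d a).det = (coeffMatrix d b).det := by
  congr 1
  ext s t
  simp only [coeffMatrix_apply]
  split_ifs
  · exact coeff_pow_congr _ _ fun i hi => h i ((hi.trans (Nat.sub_le _ _)).trans_lt s.deg_lt)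
  · rfl

theorem abs_coeffMatrix_le (d : ℕ) {a : ℕ → ℝ} (ha : ∀ i, |a i| ≤ 1) (s t : Idx d) :
    |coeffMatrix d a s t| ≤ (((d : ℝ) + 1) ^ 2) ^ d := by
  have h1 : (1 : ℝ) ≤ ((d : ℝ) + 1) ^ 2 := by nlinarith [(Nat.cast_nonneg d : (0 : ℝ) ≤ d)]
  rw [coeffMatrix_apply]
  split_ifs
  · refine (abs_coeff_pow_le ha _ _).trans ?_
    have h2 : ((s.deg - t.1 : ℕ) : ℝ) + 1 ≤ ((d : ℝ) + 1) ^ 2 := by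
      have : s.deg - t.1 + 1 ≤ (d + 1) ^ 2 := by
        have := s.deg_lt
        omega
      exact_mod_cast this
    calc _ ≤ (((d : ℝ) + 1) ^ 2) ^ (t.2 : ℕ) := by gcongr
      _ ≤ _ := pow_le_pow_right₀ h1 (Nat.lt_succ_iff.1 t.2.2)
  · rw [abs_zero]
    positivity

/-- For `f = z ^ (d + 1)` the functions `z ^ i * f ^ j` are distinct monomials. -/
theorem coeffMatrix_single (d : ℕ) : coeffMatrix d (Pi.single (d + 1) 1) = 1 := by
  have hmk : PowerSeries.mk (Pi.single (d + 1) 1 : ℕ → ℝ) = PowerSeries.X ^ (d + 1) := by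
    ext m
    rw [PowerSeries.coeff_mk, PowerSeries.coeff_X_pow, Pi.single_apply]
  ext s t
  rw [coeffMatrix, Matrix.of_apply, hmk, ← pow_mul, ← pow_add, PowerSeries.coeff_X_pow,
    Matrix.one_apply]
  exact if_congr Idx.deg_injective.eq_iff rfl rfl

/-- The point of the cube with coordinate `1` at `d + 1` and `0` elsewhere. -/
def unitPoint (d : ℕ) : Cube := fun k =>
  if k = d + 1 then ⟨1, by norm_num, le_rfl⟩ else ⟨0, by norm_num, by norm_num⟩

theorem toReal_unitPoint (d : ℕ) : toReal (unitPoint d) = Pi.single (d + 1) 1 := by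
  funext k
  unfold toReal unitPoint
  rw [Pi.single_apply]
  split_ifs <;> rfl

/-- A quantitative form of Cramer's rule. -/
theorem norm_det_mul_norm_le {ι : Type*} [Fintype ι] [DecidableEq ι] {N : Matrix ι ι ℂ} {x : ℝ}
    (hx : 1 ≤ x) (hN : ∀ i j, ‖N i j‖ ≤ x) (v : ι → ℂ) {ε : ℝ} (hε : ∀ i, ‖(N.mulVec v) i‖ ≤ ε)
    (s : ι) :
    ‖N.det‖ * ‖v s‖ ≤
      Fintype.card ι * ((Fintype.card ι).factorial * x ^ Fintype.card ι * ε) := by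
  have hadj : ∀ j, ‖N.adjugate s j‖ ≤ (Fintype.card ι).factorial * x ^ Fintype.card ι := by
    intro j
    rw [Matrix.adjugate_apply, ← nsmul_eq_mul]
    refine Matrix.det_le (abv := NormedField.toAbsoluteValue ℂ) fun k l => ?_
    change ‖N.updateRow j (Pi.single s 1) k l‖ ≤ x
    rw [Matrix.updateRow_apply]
    split_ifs
    · rw [Pi.single_apply]
      split_ifs
      · simpa using hx
      · simpa using zero_le_one.trans hx
    · exact hN k l
  have hcr : N.det * v s = ∑ j, N.adjugate s j * (N.mulVec v) j := by
    have h1 := congrFun (Matrix.mulVec_mulVec v N.adjugate N) s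
    rw [Matrix.adjugate_mul, Matrix.smul_mulVec, Matrix.one_mulVec] at h1
    exact h1.symm
  rw [← norm_mul, hcr]
  refine (norm_sum_le _ _).trans ?_
  calc _ ≤ ∑ _j : ι, ((Fintype.card ι).factorial * x ^ Fintype.card ι * ε) := by
        refine Finset.sum_le_sum fun j _ => ?_
        rw [norm_mul]
        exact mul_le_mul (hadj j) (hε j) (norm_nonneg _) (by positivity)
    _ = _ := by rw [Finset.sum_const, nsmul_eq_mul, Finset.card_univ]


/-! ### Bézout bounds when the determinant is not small -/

theorem isSumOnDisc_seriesFun (a : Cube) :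
    IsSumOnDisc (PowerSeries.mk fun k => ((a k : ℝ) : ℂ)) (seriesFun a) := by
  intro z hz
  simp only [PowerSeries.coeff_mk]
  refine ⟨Summable.of_nonneg_of_le (fun _ => norm_nonneg _) (fun k => ?_)
    (summable_geometric_of_lt_one (norm_nonneg z) hz), rfl⟩
  rw [norm_mul, norm_pow, Complex.norm_real, Real.norm_eq_abs]
  exact mul_le_of_le_one_left (by positivity) (abs_le.2 (a k).2)

theorem norm_seriesFun_le (a : Cube) {z : ℂ} (hz : ‖z‖ ≤ 7 / 8) : ‖seriesFun a z‖ ≤ 8 := by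
  have hgeom : HasSum (fun k : ℕ => (7 / 8 : ℝ) ^ k) 8 := by
    have := hasSum_geometric_of_lt_one (r := (7 / 8 : ℝ)) (by norm_num) (by norm_num)
    norm_num at this
    exact this
  refine tsum_of_norm_bounded hgeom fun k => ?_
  rw [norm_mul, norm_pow, Complex.norm_real, Real.norm_eq_abs]
  calc _ ≤ 1 * ‖z‖ ^ k := mul_le_mul_of_nonneg_right (abs_le.2 (a k).2) (by positivity)
    _ ≤ _ := by rw [one_mul]; gcongr

/-- The coefficient vector of a polynomial `∑ p_j(z) w ^ j`. -/
noncomputable def coeffVec {d : ℕ} (p : Fin (d + 1) → ℂ[X]) (t : Idx d) : ℂ :=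
  (p t.2).coeff t.1

/-- This is where the analytic problem becomes a linear system: taking Taylor coefficients is linear
in the coefficients of the `p_j`. -/
theorem coeff_sum_mul_pow {d : ℕ} (a : ℕ → ℝ) {p : Fin (d + 1) → ℂ[X]}
    (hp : ∀ j, (p j).natDegree ≤ d) (s : Idx d) :
    PowerSeries.coeff s.deg (∑ j : Fin (d + 1), (p j : PowerSeries ℂ) *
        (PowerSeries.mk fun k => (a k : ℂ)) ^ (j : ℕ)) =
      ((coeffMatrix d a).map Complex.ofRealHom).mulVec (coeffVec p) s := by
  have hF : (PowerSeries.mk fun k => (a k : ℂ)) =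
      PowerSeries.map Complex.ofRealHom (PowerSeries.mk a) := by
    ext k
    simp
  have hpj : ∀ j, (p j : PowerSeries ℂ) = ∑ i : Fin (d + 1),
      PowerSeries.C ((p j).coeff i) * PowerSeries.X ^ (i : ℕ) := by
    intro j
    ext m
    rw [map_sum, Polynomial.coeff_coe]
    simp only [PowerSeries.coeff_C_mul, PowerSeries.coeff_X_pow]
    rw [Fin.sum_univ_eq_sum_range (fun i => (p j).coeff i * if m = i then 1 else 0) (d + 1)]
    simp only [mul_ite, mul_one, mul_zero, Finset.sum_ite_eq, Finset.mem_range]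
    split_ifs with hm
    · rfl
    · exact Polynomial.coeff_eq_zero_of_natDegree_lt ((hp j).trans_lt (by omega))
  rw [Matrix.mulVec, dotProduct, Fintype.sum_prod_type_right, map_sum]
  refine Finset.sum_congr rfl fun j _ => ?_
  rw [hpj, Finset.sum_mul, map_sum]
  refine Finset.sum_congr rfl fun i _ => ?_
  rw [mul_assoc, PowerSeries.coeff_C_mul, mul_comm, hF, ← PowerSeries.map_X Complex.ofRealHom,
    ← map_pow, ← map_pow, ← map_mul, PowerSeries.coeff_map]
  rfl

theorem norm_sum_eval_mul_pow_le (a : Cube) {d : ℕ} {p : Fin (d + 1) → ℂ[X]}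
    (hp : ∀ j, (p j).natDegree ≤ d) {V : ℝ} (hV : ∀ t, ‖coeffVec p t‖ ≤ V) {z : ℂ}
    (hz : ‖z‖ ≤ 7 / 8) :
    ‖∑ j : Fin (d + 1), (p j).eval z * seriesFun a z ^ (j : ℕ)‖ ≤
      ((d : ℝ) + 1) ^ 2 * 8 ^ d * V := by
  have hV0 : 0 ≤ V := (norm_nonneg _).trans (hV 0)
  have heval : ∀ j, ‖(p j).eval z‖ ≤ ((d : ℝ) + 1) * V := by
    intro j
    rw [Polynomial.eval_eq_sum_range' (Nat.lt_succ_of_le (hp j)),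
      ← Fin.sum_univ_eq_sum_range (fun i => (p j).coeff i * z ^ i) (d + 1)]
    refine (norm_sum_le _ _).trans ?_
    calc _ ≤ ∑ _i : Fin (d + 1), V := by
          refine Finset.sum_le_sum fun i _ => ?_
          rw [norm_mul, norm_pow]
          exact (mul_le_of_le_one_right (norm_nonneg _)
            (pow_le_one₀ (norm_nonneg _) (by linarith))).trans (hV (i, j))
      _ = _ := by simp
  refine (norm_sum_le _ _).trans ?_
  calc _ ≤ ∑ _j : Fin (d + 1), ((d : ℝ) + 1) * V * 8 ^ d := by
        refine Finset.sum_le_sum fun j _ => ?_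
        rw [norm_mul, norm_pow]
        refine mul_le_mul (heval j) ?_ (by positivity) (by positivity)
        calc _ ≤ (8 : ℝ) ^ (j : ℕ) := by
              gcongr
              exact norm_seriesFun_le a hz
          _ ≤ _ := pow_le_pow_right₀ (by norm_num) (Nat.lt_succ_iff.1 j.2)
    _ = _ := by
      simp only [Finset.sum_const, Finset.card_univ, Fintype.card_fin, nsmul_eq_mul]
      push_cast
      ring

/-- A lower bound for the determinant of `coeffMatrix` bounds the number of zeros. -/
theorem bezoutNumber_le_of_det {a : Cube} {d n T : ℕ} (hn : n = (d + 1) ^ 2)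
    (hT : (n : ℝ) ^ 2 * 8 ^ d * (n.factorial * ((n : ℝ) ^ d) ^ n) * 4 ^ n ≤
      |(coeffMatrix d (toReal a)).det| * 2 ^ T) :
    bezoutNumber (seriesFun a) (Metric.closedBall 0 (1 / 4)) d ≤ (4 * T : ℕ) := by
  have hn' : (n : ℝ) = ((d : ℝ) + 1) ^ 2 := by rw [hn]; push_cast; ring
  have hn1 : (1 : ℝ) ≤ n := by
    rw [hn']
    nlinarith [(Nat.cast_nonneg d : (0 : ℝ) ≤ d)]
  refine iSup_le fun ⟨p, hp, hp0⟩ => zeroCount_le_of_multiset fun S hS hord => ?_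
  set g : ℂ → ℂ := fun z => ∑ j : Fin (d + 1), (p j).eval z * seriesFun a z ^ (j : ℕ) with hg
  set P : PowerSeries ℂ := ∑ j : Fin (d + 1), (p j : PowerSeries ℂ) *
    (PowerSeries.mk fun k => ((a k : ℝ) : ℂ)) ^ (j : ℕ) with hP
  have hPg : IsSumOnDisc P g := IsSumOnDisc.sum _ fun j _ =>
    (isSumOnDisc_polynomial (p j)).mul ((isSumOnDisc_seriesFun a).pow j)
  obtain ⟨s, -, hs⟩ := Finset.exists_max_image Finset.univ (fun t => ‖coeffVec p t‖)
    Finset.univ_nonempty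
  set V := ‖coeffVec p s‖ with hV
  have hV0 : 0 < V := by
    by_contra! hneg
    refine hp0 (funext fun j => Polynomial.ext fun i => ?_)
    by_cases hi : i < d + 1
    · have h0 := (hs ((⟨i, hi⟩, j) : Idx d) (Finset.mem_univ _)).trans hneg
      exact norm_le_zero_iff.1 h0
    · exact Polynomial.coeff_eq_zero_of_natDegree_lt ((hp j).trans_lt (by omega))
  have hB : ∀ z ∈ Metric.sphere (0 : ℂ) (7 / 8), ‖g z‖ ≤ n * 8 ^ d * V := by
    intro z hz
    rw [hn']
    exact norm_sum_eval_mul_pow_le a hp (fun t => hs t (Finset.mem_univ t)) (by simp_all)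
  set ε : ℝ := n * 8 ^ d * V * (4 / 5) ^ S.card * 4 ^ n with hε
  have hcoeff : ∀ t : Idx d, ‖PowerSeries.coeff t.deg P‖ ≤ ε := by
    intro t
    have h1 := hPg.norm_coeff_le (r := 1 / 4) (by norm_num) (by norm_num)
      (fun z hz => norm_le_of_zeros hPg.differentiableOn hB S hS hord
        (Metric.sphere_subset_closedBall hz)) t.deg
    refine h1.trans ?_
    rw [one_div, inv_pow, div_inv_eq_mul]
    have : (4 : ℝ) ^ t.deg ≤ 4 ^ n :=
      pow_le_pow_right₀ (by norm_num) (hn ▸ t.deg_lt.le)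
    exact mul_le_mul_of_nonneg_left this (by positivity)
  have hcr := norm_det_mul_norm_le (N := (coeffMatrix d (toReal a)).map Complex.ofRealHom)
    (x := (n : ℝ) ^ d) (one_le_pow₀ hn1) (fun i j => by
      rw [Matrix.map_apply, Complex.ofRealHom_eq_coe, Complex.norm_real, hn']
      exact abs_coeffMatrix_le d (fun k => abs_le.2 (a k).2) i j) (coeffVec p)
    (fun t => (coeff_sum_mul_pow (toReal a) hp t) ▸ hcoeff t) s
  have hdet : ‖((coeffMatrix d (toReal a)).map Complex.ofRealHom).det‖ =
      |(coeffMatrix d (toReal a)).det| := by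
    rw [← RingHom.mapMatrix_apply, ← RingHom.map_det, Complex.ofRealHom_eq_coe, Complex.norm_real,
      Real.norm_eq_abs]
  rw [hdet, Idx.card, ← hn] at hcr
  have h5 : |(coeffMatrix d (toReal a)).det| * (5 / 4) ^ S.card ≤
      (n : ℝ) ^ 2 * 8 ^ d * (n.factorial * ((n : ℝ) ^ d) ^ n) * 4 ^ n := by
    have h45 : (4 / 5 : ℝ) ^ S.card * (5 / 4) ^ S.card = 1 := by
      rw [← mul_pow]; norm_num
    refine le_of_mul_le_mul_right ?_ hV0
    calc _ = |(coeffMatrix d (toReal a)).det| * V * (5 / 4) ^ S.card := by ring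
      _ ≤ _ := mul_le_mul_of_nonneg_right hcr (by positivity)
      _ = (n : ℝ) ^ 2 * 8 ^ d * (n.factorial * ((n : ℝ) ^ d) ^ n) * 4 ^ n * V *
          ((4 / 5 : ℝ) ^ S.card * (5 / 4) ^ S.card) := by rw [hε]; ring
      _ = _ := by rw [h45, mul_one]
  have hpos : 0 < |(coeffMatrix d (toReal a)).det| := by
    refine abs_pos.2 fun h0 => ?_
    rw [h0, abs_zero, zero_mul] at hT
    have : 0 < (n : ℝ) ^ 2 * 8 ^ d * (n.factorial * ((n : ℝ) ^ d) ^ n) * 4 ^ n := by positivity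
    linarith
  have h6 : (5 / 4 : ℝ) ^ S.card ≤ 2 ^ T := le_of_mul_le_mul_left (h5.trans hT) hpos
  -- The factor `4` in the bound comes from `(5/4) ^ 4 ≥ 2`.
  have h7 : (2 : ℝ) ^ S.card ≤ 2 ^ (4 * T) := by
    calc (2 : ℝ) ^ S.card ≤ ((5 / 4 : ℝ) ^ 4) ^ S.card := by gcongr; norm_num
      _ = ((5 / 4 : ℝ) ^ S.card) ^ 4 := by rw [← pow_mul, ← pow_mul, mul_comm]
      _ ≤ (2 ^ T) ^ 4 := by gcongr
      _ = _ := by rw [← pow_mul, mul_comm]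
  exact (pow_le_pow_iff_right₀ (by norm_num)).1 h7

/-! ### The exceptional sets -/

/-- The set of points of the cube at which the determinant of `coeffMatrix d` is not too small. -/
def goodSet (K d : ℕ) : Set Cube :=
  {a | ((1 / 2 : ℝ) ^ (K + 6 * d + 2)) ^ ((d + 1) ^ 2 * d * (d + 1) ^ 2) ≤
    |(coeffMatrix d (toReal a)).det|}

theorem measurableSet_goodSet (K d : ℕ) : MeasurableSet (goodSet K d) :=
  measurableSet_le measurable_const
    ((continuous_det_coeffMatrix d).comp continuous_toReal).abs.measurable

theorem succ_sq_le_two_pow (d : ℕ) : (d + 1) ^ 2 ≤ 2 ^ (2 * d) := by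
  rw [mul_comm, pow_mul]
  exact Nat.pow_le_pow_left Nat.lt_two_pow_self 2

/-- With `n ≤ 2 ^ (2 * d)` and `d ≤ 2 ^ d`, the failure bound `n * (n * d * r)` is at most `2 ^ (5 *
d) * r`. The `6 * d` in the exponent of `r` leaves a summable `2 ^ (-d)`; the extra `2` in `goodSet`
comes from `r / (r + 2) ≥ r / 4`. -/
theorem cubeMeasure_compl_goodSet_le (K d : ℕ) :
    cubeMeasure (goodSet K d)ᶜ ≤ ENNReal.ofReal ((1 / 2) ^ (K + d)) := by
  set r : ℝ := (1 / 2) ^ (K + 6 * d) with hr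
  have hr0 : 0 < r := by positivity
  have hr1 : r ≤ 1 := pow_le_one₀ (by norm_num) (by norm_num)
  have hmain := cubeMeasure_abs_lt_le (n := (d + 1) ^ 2) (isCoordPoly_det_coeffMatrix d)
    (continuous_det_coeffMatrix d) (fun a b => det_coeffMatrix_congr d) (unitPoint d)
    (by rw [toReal_unitPoint, coeffMatrix_single, Matrix.det_one, abs_one]) hr0
  have hc : (1 / 2 : ℝ) ^ (K + 6 * d + 2) ≤ r / (r + 2) := by
    rw [pow_add, ← hr, le_div_iff₀ (by positivity)]
    nlinarith
  have hsub : (goodSet K d)ᶜ ⊆ {a | |(coeffMatrix d (toReal a)).det| <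
      (r / (r + 2)) ^ ((d + 1) ^ 2 * d * (d + 1) ^ 2)} := by
    intro a ha
    have ha' : ¬ _ ≤ |(coeffMatrix d (toReal a)).det| := ha
    exact (not_le.1 ha').trans_le (by gcongr)
  refine (measure_mono hsub).trans (hmain.trans (ENNReal.ofReal_le_ofReal ?_))
  have hn : (((d + 1) ^ 2 : ℕ) : ℝ) ≤ 2 ^ (2 * d) := by exact_mod_cast succ_sq_le_two_pow d
  have hd : (d : ℝ) ≤ 2 ^ d := by exact_mod_cast Nat.lt_two_pow_self.le
  calc ((((d + 1) ^ 2 : ℕ) : ℝ)) * ((((d + 1) ^ 2 * d : ℕ) : ℝ) * r)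
      = (((d + 1) ^ 2 : ℕ) : ℝ) * ((((d + 1) ^ 2 : ℕ) : ℝ) * d * r) := by push_cast; ring
    _ ≤ 2 ^ (2 * d) * (2 ^ (2 * d) * 2 ^ d * r) := by gcongr
    _ = (2 * (1 / 2) : ℝ) ^ (5 * d) * (1 / 2) ^ (K + d) := by
      rw [hr, mul_pow]
      ring
    _ = _ := by norm_num

theorem bezoutNumber_le_of_mem_goodSet {K d : ℕ} (hd : 1 ≤ d) {a : Cube} (ha : a ∈ goodSet K d) :
    bezoutNumber (seriesFun a) (Metric.closedBall 0 (1 / 4)) d ≤ ((636 + 64 * K) * d ^ 8 : ℕ) := by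
  obtain ⟨n, hn⟩ : ∃ n, n = (d + 1) ^ 2 := ⟨_, rfl⟩
  set L := K + 6 * d + 2 with hL
  -- `U` collects the binary exponents after bounding `n` by `2 ^ (2 * d)` and `n.factorial` by `n ^
  -- n`.
  set U := 7 * d + 2 * d * n + 2 * d * d * n + 2 * n with hU
  have hn2 : n ≤ 2 ^ (2 * d) := hn ▸ succ_sq_le_two_pow d
  have hlow : n ^ 2 * 8 ^ d * (n.factorial * (n ^ d) ^ n) * 4 ^ n ≤ 2 ^ U := by
    calc n ^ 2 * 8 ^ d * (n.factorial * (n ^ d) ^ n) * 4 ^ n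
        ≤ (2 ^ (2 * d)) ^ 2 * 8 ^ d * ((2 ^ (2 * d)) ^ n * ((2 ^ (2 * d)) ^ d) ^ n) * 4 ^ n := by
          gcongr
          exact (Nat.factorial_le_pow n).trans (Nat.pow_le_pow_left hn2 n)
      _ = 2 ^ U := by
        rw [show 8 = 2 ^ 3 by norm_num, show 4 = 2 ^ 2 by norm_num, hU]
        simp only [← pow_mul, ← pow_add]
        congr 1
        ring
  have hdet : ((1 / 2 : ℝ) ^ L) ^ (n * d * n) ≤ |(coeffMatrix d (toReal a)).det| := by
    rw [hn]
    exact ha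
  have hT := bezoutNumber_le_of_det (a := a) (T := U + L * (n * d * n)) hn (by
    calc _ ≤ (2 : ℝ) ^ U := by exact_mod_cast hlow
      _ = ((1 / 2 : ℝ) ^ L) ^ (n * d * n) * 2 ^ (U + L * (n * d * n)) := by
        rw [← pow_mul, pow_add (2 : ℝ) U, mul_left_comm, ← mul_pow]
        norm_num
      _ ≤ _ := mul_le_mul_of_nonneg_right hdet (by positivity))
  refine hT.trans ?_
  norm_cast
  have hn4 : n ≤ 4 * d ^ 2 := by
    rw [hn]
    nlinarith
  have hpow : ∀ k ≤ 8, d ^ k ≤ d ^ 8 := fun k hk => Nat.pow_le_pow_right hd hk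
  calc 4 * (U + L * (n * d * n))
      ≤ 4 * ((7 * d + 2 * d * (4 * d ^ 2) + 2 * d * d * (4 * d ^ 2) + 2 * (4 * d ^ 2)) +
        L * (4 * d ^ 2 * d * (4 * d ^ 2))) := by
        rw [hU]
        gcongr
    _ = 28 * d ^ 1 + 32 * d ^ 3 + 32 * d ^ 4 + 32 * d ^ 2 +
        (64 * K + 128) * d ^ 5 + 384 * d ^ 6 := by
        rw [hL]
        ring
    _ ≤ 28 * d ^ 8 + 32 * d ^ 8 + 32 * d ^ 8 + 32 * d ^ 8 +
        (64 * K + 128) * d ^ 8 + 384 * d ^ 8 := by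
        gcongr <;> omega
    _ = _ := by ring

/-- The points of the cube that are good for every `d ≥ 1`. -/
def allGoodSet (K : ℕ) : Set Cube := ⋂ d : ℕ, goodSet K (d + 1)

theorem measurableSet_allGoodSet (K : ℕ) : MeasurableSet (allGoodSet K) :=
  MeasurableSet.iInter fun _ => measurableSet_goodSet _ _

theorem cubeMeasure_compl_allGoodSet_le (K : ℕ) :
    cubeMeasure (allGoodSet K)ᶜ ≤ ENNReal.ofReal ((1 / 2) ^ K) := by
  rw [allGoodSet, Set.compl_iInter]
  have hsum : HasSum (fun d : ℕ => (1 / 2 : ℝ) ^ (K + (d + 1))) ((1 / 2) ^ K) := by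
    have h := hasSum_geometric_two.mul_left ((1 / 2 : ℝ) ^ (K + 1))
    have h2 : (1 / 2 : ℝ) ^ (K + 1) * 2 = (1 / 2) ^ K := by rw [pow_succ]; ring
    rw [h2] at h
    refine h.congr_fun ?_
    intro d
    rw [← pow_add]
    congr 1
    ring
  calc _ ≤ ∑' d, cubeMeasure (goodSet K (d + 1))ᶜ := measure_iUnion_le _
    _ ≤ ∑' d, ENNReal.ofReal ((1 / 2) ^ (K + (d + 1))) :=
      ENNReal.tsum_le_tsum fun d => cubeMeasure_compl_goodSet_le K (d + 1)
    _ = _ := by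
      rw [← ENNReal.ofReal_tsum_of_nonneg (fun _ => by positivity) hsum.summable, hsum.tsum_eq]

theorem bezoutNumber_le_of_mem_allGoodSet {K : ℕ} {a : Cube} (ha : a ∈ allGoodSet K) {C : ℝ}
    (hC : 636 + 64 * (K : ℝ) ≤ C) {d : ℕ} (hd : 1 ≤ d) :
    (bezoutNumber (seriesFun a) (Metric.closedBall (0 : ℂ) (1 / 4)) d : ℝ≥0∞) ≤
      ENNReal.ofReal (C * (d : ℝ) ^ 8) := by
  obtain ⟨e, rfl⟩ := Nat.exists_eq_add_of_le' hd
  have h1 := bezoutNumber_le_of_mem_goodSet hd (Set.mem_iInter.1 ha e)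
  have h2 := ENat.toENNReal_mono h1
  refine h2.trans ?_
  rw [ENat.toENNReal_coe, ← ENNReal.ofReal_natCast]
  refine ENNReal.ofReal_le_ofReal ?_
  push_cast
  gcongr

/-! ### Subsets of prescribed measure -/

theorem cubeMeasure_apply_zero_le_sub (s t : ℝ) :
    cubeMeasure {a : Cube | s < a 0 ∧ (a 0 : ℝ) ≤ t} ≤ ENNReal.ofReal (t - s) := by
  have hmeas : MeasurableSet {x : I | s < x ∧ (x : ℝ) ≤ t} :=
    (measurableSet_lt measurable_const measurable_subtype_coe).inter
      (measurableSet_le measurable_subtype_coe measurable_const)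
  have hmp := measurePreserving_eval_infinitePi (fun _ : ℕ => uniformI) 0
  have h := hmp.measure_preimage hmeas.nullMeasurableSet
  change cubeMeasure {a : Cube | s < a 0 ∧ (a 0 : ℝ) ≤ t} = _ at h
  rw [h, uniformI_apply]
  calc _ ≤ 1 * volume (Set.Ioc s t) := by
        gcongr
        · exact ENNReal.inv_le_one.2 (by norm_num)
        · rintro _ ⟨x, hx, rfl⟩
          exact hx
    _ = _ := by rw [one_mul, Real.volume_Ioc]

/-- The measure of `G ∩ {a 0 ≤ t}` is Lipschitz in `t`, because `a 0` has bounded density, so it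
takes every intermediate value. -/
theorem exists_subset_cubeMeasure_eq {G : Set Cube} (hG : MeasurableSet G) {p : ℝ} (hp : 0 ≤ p)
    (hpG : ENNReal.ofReal p ≤ cubeMeasure G) :
    ∃ E ⊆ G, MeasurableSet E ∧ cubeMeasure E = ENNReal.ofReal p := by
  set S : ℝ → Set Cube := fun t => G ∩ {a | (a 0 : ℝ) ≤ t} with hS
  have hmeas0 : Measurable fun a : Cube => (a 0 : ℝ) :=
    measurable_subtype_coe.comp (measurable_pi_apply 0)
  have hSm : ∀ t, MeasurableSet (S t) := fun t =>
    hG.inter (measurableSet_le hmeas0 measurable_const)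
  have hstep : ∀ s t, s ≤ t → cubeMeasure.real (S t) ≤ cubeMeasure.real (S s) + (t - s) := by
    intro s t hst
    have hsub : S t ⊆ S s ∪ {a : Cube | s < a 0 ∧ (a 0 : ℝ) ≤ t} := by
      rintro a ⟨haG, hat⟩
      by_cases h : (a 0 : ℝ) ≤ s
      · exact Or.inl ⟨haG, h⟩
      · exact Or.inr ⟨not_le.1 h, hat⟩
    refine ((measureReal_mono hsub).trans (measureReal_union_le _ _)).trans ?_
    gcongr
    exact ENNReal.toReal_le_of_le_ofReal (sub_nonneg.2 hst) (cubeMeasure_apply_zero_le_sub s t)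
  have hmono : Monotone fun t => cubeMeasure.real (S t) := fun s t hst =>
    measureReal_mono fun a ha => ⟨ha.1, le_trans ha.2 hst⟩
  have hcont : Continuous fun t => cubeMeasure.real (S t) := by
    refine (LipschitzWith.of_le_add fun t s => ?_).continuous
    rcases le_total s t with h | h
    · rw [Real.dist_eq, abs_of_nonneg (sub_nonneg.2 h)]
      exact hstep s t h
    · exact (hmono h).trans (le_add_of_nonneg_right dist_nonneg)
  have hleft : cubeMeasure.real (S (-2)) = 0 := by
    have : S (-2) = ∅ := by
      ext a
      have := (a 0).2.1
      simp only [hS, Set.mem_inter_iff, Set.mem_ofPred_eq, Set.mem_empty_iff_false, iff_false,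
        not_and, not_le]
      intro _
      linarith
    rw [this, measureReal_empty]
  have hright : cubeMeasure.real (S 1) = cubeMeasure.real G := by
    congr 1
    exact Set.inter_eq_left.2 fun a _ => (a 0).2.2
  have hmem : p ∈ Set.Icc (cubeMeasure.real (S (-2))) (cubeMeasure.real (S 1)) := by
    rw [hleft, hright]
    exact ⟨hp, (ENNReal.ofReal_le_iff_le_toReal (measure_ne_top _ _)).1 hpG⟩
  obtain ⟨t, -, ht⟩ := intermediate_value_Icc (by norm_num : (-2 : ℝ) ≤ 1) hcont.continuousOn hmem
  refine ⟨S t, Set.inter_subset_left, hSm t, ?_⟩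
  rw [← ht]
  change _ = ENNReal.ofReal (cubeMeasure.real (S t))
  rw [measureReal_def, ENNReal.ofReal_toReal (measure_ne_top _ _)]

theorem ofReal_le_cubeMeasure_allGoodSet {K : ℕ} {p : ℝ} (hp : p ≤ 1 - (1 / 2) ^ K) :
    ENNReal.ofReal p ≤ cubeMeasure (allGoodSet K) := by
  have h := cubeMeasure_compl_allGoodSet_le K
  have h1 : cubeMeasure (allGoodSet K) = 1 - cubeMeasure (allGoodSet K)ᶜ := by
    rw [← prob_compl_eq_one_sub (measurableSet_allGoodSet K).compl, compl_compl]
  rw [h1]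
  calc ENNReal.ofReal p ≤ ENNReal.ofReal (1 - (1 / 2) ^ K) := ENNReal.ofReal_le_ofReal hp
    _ = 1 - ENNReal.ofReal ((1 / 2) ^ K) := by
      rw [ENNReal.ofReal_sub _ (by positivity), ENNReal.ofReal_one]
    _ ≤ _ := tsub_le_tsub_left h 1

theorem ae_exists_mem_allGoodSet : ∀ᵐ a ∂cubeMeasure, ∃ K, a ∈ allGoodSet K := by
  have hle : ∀ K : ℕ, cubeMeasure {a | ¬ ∃ K, a ∈ allGoodSet K} ≤
      ENNReal.ofReal ((1 / 2) ^ K) := fun K =>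
    (measure_mono fun a (ha : ¬ ∃ K, a ∈ allGoodSet K) hK => ha ⟨K, hK⟩).trans (cubeMeasure_compl_allGoodSet_le K)
  have hlim : Tendsto (fun K : ℕ => ENNReal.ofReal ((1 / 2) ^ K)) atTop (𝓝 0) := by
    have := ENNReal.tendsto_ofReal
      (tendsto_pow_atTop_nhds_zero_of_lt_one (r := (1 / 2 : ℝ)) (by norm_num) (by norm_num))
    rwa [ENNReal.ofReal_zero] at this
  exact le_antisymm (ge_of_tendsto' hlim hle) zero_le

end RandomBezout

/-! ### Choice of the constants and conclusion -/

theorem mainTheorem5 :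
    (∃ C : ℝ → ℝ, Tendsto C (𝓝[<] (1 : ℝ)) atTop ∧
      ∀ p : ℝ, p ∈ Set.Ioo (0 : ℝ) 1 →
        ∃ E : Set RandomBezout.Cube, MeasurableSet E ∧
          RandomBezout.cubeMeasure E = ENNReal.ofReal p ∧
          ∀ a ∈ E, ∀ d : ℕ, 1 ≤ d →
            (RandomBezout.bezoutNumber (RandomBezout.seriesFun a)
                (Metric.closedBall (0 : ℂ) (1 / 4)) d : ℝ≥0∞) ≤
              ENNReal.ofReal (C p * (d : ℝ) ^ 8)) ∧
    (∀ᵐ a ∂(RandomBezout.cubeMeasure), ∃ C : ℝ, ∀ d : ℕ, 1 ≤ d →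
      (RandomBezout.bezoutNumber (RandomBezout.seriesFun a)
          (Metric.closedBall (0 : ℂ) (1 / 4)) d : ℝ≥0∞) ≤
        ENNReal.ofReal (C * (d : ℝ) ^ 8)) := by
  have hK : ∀ p : ℝ, ∃ K : ℕ, p < 1 → p ≤ 1 - (1 / 2) ^ K := by
    intro p
    by_cases hp : p < 1
    · obtain ⟨K, hK⟩ := exists_pow_lt_of_lt_one (sub_pos.2 hp) (by norm_num : (1 / 2 : ℝ) < 1)
      exact ⟨K, fun _ => by linarith⟩
    · exact ⟨0, fun h => absurd h hp⟩
  choose K hK using hK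
  constructor
  · refine ⟨fun p => 636 + 64 * (K p : ℝ) + |(1 - p)⁻¹|, ?_, fun p hp => ?_⟩
    · have hsub : Tendsto (fun p : ℝ => 1 - p) (𝓝[<] 1) (𝓝[>] 0) := by
        refine tendsto_nhdsWithin_iff.2 ⟨?_, ?_⟩
        · have : Tendsto (fun p : ℝ => 1 - p) (𝓝 1) (𝓝 (1 - 1)) :=
            (continuous_const.sub continuous_id).tendsto 1
          rw [sub_self] at this
          exact this.mono_left nhdsWithin_le_nhds
        · filter_upwards [self_mem_nhdsWithin] with p hp using sub_pos.2 (Set.mem_Iio.1 hp)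
      refine tendsto_atTop_mono (fun p => ?_) (tendsto_inv_nhdsGT_zero.comp hsub)
      have := le_abs_self (1 - p)⁻¹
      simp only [Function.comp_apply]
      linarith [(Nat.cast_nonneg (K p) : (0 : ℝ) ≤ K p)]
    · obtain ⟨E, hEG, hE, hEp⟩ := RandomBezout.exists_subset_cubeMeasure_eq
        (RandomBezout.measurableSet_allGoodSet (K p)) hp.1.le
        (RandomBezout.ofReal_le_cubeMeasure_allGoodSet (hK p hp.2))
      exact ⟨E, hE, hEp, fun a ha d hd => RandomBezout.bezoutNumber_le_of_mem_allGoodSet (hEG ha)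
        (le_add_of_nonneg_right (abs_nonneg _)) hd⟩
  · filter_upwards [RandomBezout.ae_exists_mem_allGoodSet] with a ⟨L, ha⟩
    exact ⟨636 + 64 * (L : ℝ), fun d hd =>
      RandomBezout.bezoutNumber_le_of_mem_allGoodSet ha le_rfl hd⟩
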